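/- Let $c_{00}$ be the space of finitely supported real sequences $x=(x_i)_{i\ge 1}$ indexed by the positive integers $\mathbb{N}=\{1,2,\dots\}$. For $E\subset\mathbb{N}$ let $Ex$ denote the restriction of $x$ to the coordinates in $E$ (the other coordinates being set to $0$), and for nonempty finite sets write $E<F$ if $\max E<\min F$. Let $\mathcal{S}_1=\{F\subset\mathbb{N} \text{ finite, nonempty}: \operatorname{card}F\le\min F\}\cup\{\emptyset\}$ be the Schreier family. For $\theta\in(0,1)$ define norms on $c_{00}$ inductively by $\|x\|_0=\sup_i|x_i|$ and $$\|x\|_{k+1}=\max\Big\{\|x\|_k,\ \sup\Big\{\theta\sum_{i=1}^d\|E_ix\|_k:\ E_1<\cdots<E_d \text{ nonempty finite subsets of } \mathbb{N},\ \{\min E_1,\dots,\min E_d\}\in\mathcal{S}_1\Big\}\Big\},$$ and let $T[\theta,\mathcal{S}_1]$ be the real Banach space obtained by completing $c_{00}$ in the norm $\|x\|=\sup_{k\ge 0}\|x\|_k$. Let $n\ge 2$ be an integer. Then every linear isometry $U:T[\tfrac1n,\mathcal{S}_1]\to T[\tfrac1n,\mathcal{S}_1]$ (that is, every linear map with $\|Ux\|=\|x\|$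 for all $x$) is surjective. -/

import Mathlib

/-- The Schreier family `S₁`: the finite sets `F ⊆ {1, 2, 3, …}` with `card F ≤ min F`, together
with the empty set. -/
def schreierFamily : Set (Finset ℕ+) :=
  {F | F = ∅ ∨ ∃ h : F.Nonempty, F.card ≤ ((F.min' h : ℕ+) : ℕ)}

/-- `E₁ < ⋯ < E_d` are consecutive nonempty finite sets of positive integers (`max E_i < min E_j`
for `i < j`) with `{min E₁, …, min E_d} ∈ F`. Only finite sets are needed, since the
vectors they are applied to are finitely supported. -/
def IsAdmissible (F : Set (Finset ℕ+)) {d : ℕ} (E : Fin d → Finset ℕ+) : Prop :=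
  (∀ i j, i < j → ∀ a ∈ E i, ∀ b ∈ E j, a < b) ∧
    ∃ h : ∀ i, (E i).Nonempty, (Finset.univ.image fun i => (E i).min' (h i)) ∈ F

/-- The coordinate projection `E x` of a finitely supported sequence `x`. -/
noncomputable def coordProj (E : Finset ℕ+) (x : ℕ+ →₀ ℝ) : ℕ+ →₀ ℝ :=
  x.filter (· ∈ E)

/-- The inductively defined norms `‖x‖₀, ‖x‖₁, ‖x‖₂, …` on `c₀₀`. -/
noncomputable def tsirelsonNormAux (θ : ℝ) (F : Set (Finset ℕ+)) : ℕ → (ℕ+ →₀ ℝ) → ℝ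
  | 0, x => ⨆ i, |x i|
  | k + 1, x => max (tsirelsonNormAux θ F k x)
      (sSup {r : ℝ | ∃ (d : ℕ) (E : Fin d → Finset ℕ+), IsAdmissible F E ∧
        r = θ * ∑ i, tsirelsonNormAux θ F k (coordProj (E i) x)})

/-- The norm `‖x‖ = sup_k ‖x‖_k` on `c₀₀`. -/
noncomputable def tsirelsonNorm (θ : ℝ) (F : Set (Finset ℕ+)) (x : ℕ+ →₀ ℝ) : ℝ :=
  ⨆ k, tsirelsonNormAux θ F k x

section TsirelsonNormFacts

variable {θ : ℝ} {F : Set (Finset ℕ+)}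

theorem coordProj_apply (E : Finset ℕ+) (x : ℕ+ →₀ ℝ) (i : ℕ+) :
    coordProj E x i = if i ∈ E then x i else 0 := by
  classical
  simp [coordProj, Finsupp.filter_apply]

theorem coordProj_add (E : Finset ℕ+) (x y : ℕ+ →₀ ℝ) :
    coordProj E (x + y) = coordProj E x + coordProj E y := Finsupp.filter_add

theorem coordProj_smul (E : Finset ℕ+) (c : ℝ) (x : ℕ+ →₀ ℝ) :
    coordProj E (c • x) = c • coordProj E x := Finsupp.filter_smul

theorem bddAbove_abs_coord (x : ℕ+ →₀ ℝ) : BddAbove (Set.range fun i => |x i|) := by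
  refine ⟨∑ k ∈ x.support, |x k|, ?_⟩
  rintro _ ⟨i, rfl⟩
  by_cases hi : i ∈ x.support
  · exact Finset.single_le_sum (f := fun k => |x k|) (fun _ _ => abs_nonneg _) hi
  · simp only [Finsupp.mem_support_iff, not_not] at hi
    simpa [hi] using Finset.sum_nonneg fun k (_ : k ∈ x.support) => abs_nonneg (x k)

theorem sum_coordProj_le {d : ℕ} {E : Fin d → Finset ℕ+} (hE : IsAdmissible F E)
    (x : ℕ+ →₀ ℝ) :
    ∑ i, ∑ k ∈ (coordProj (E i) x).support, |coordProj (E i) x k| ≤ ∑ k ∈ x.support, |x k| := by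
  classical
  have h1 : ∀ i, ∑ k ∈ (coordProj (E i) x).support, |coordProj (E i) x k|
      = ∑ k ∈ x.support, if k ∈ E i then |x k| else 0 := by
    intro i
    rw [Finset.sum_subset (s₂ := x.support)]
    · refine Finset.sum_congr rfl fun k _ => ?_
      rw [coordProj_apply]
      split_ifs <;> simp
    · intro k hk
      rw [Finsupp.mem_support_iff, coordProj_apply] at hk
      rw [Finsupp.mem_support_iff]
      intro h0
      simp [h0] at hk
    · intro k _ hk
      simpa using hk
  simp_rw [h1]
  rw [Finset.sum_comm]
  refine Finset.sum_le_sum fun k _ => ?_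
  by_cases hk : ∃ i, k ∈ E i
  · obtain ⟨i, hi⟩ := hk
    rw [Finset.sum_eq_single i]
    · simp [hi]
    · intro j _ hj
      rw [if_neg]
      intro hkj
      rcases lt_or_gt_of_ne hj with h | h
      · exact lt_irrefl _ (hE.1 j i h k hkj k hi)
      · exact lt_irrefl _ (hE.1 i j h k hi k hkj)
    · simp
  · push Not at hk
    simp [hk]

theorem tsirelsonNormAux_nonneg (k : ℕ) (x : ℕ+ →₀ ℝ) : 0 ≤ tsirelsonNormAux θ F k x := by
  induction k with
  | zero => exact Real.iSup_nonneg fun _ => abs_nonneg _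
  | succ k ih => exact ih.trans (le_max_left _ _)

theorem tsirelsonNormAux_le_sum (h1 : θ ≤ 1) (k : ℕ) (x : ℕ+ →₀ ℝ) :
    tsirelsonNormAux θ F k x ≤ ∑ j ∈ x.support, |x j| := by
  have hpos : ∀ x : ℕ+ →₀ ℝ, 0 ≤ ∑ j ∈ x.support, |x j| :=
    fun x => Finset.sum_nonneg fun _ _ => abs_nonneg _
  induction k generalizing x with
  | zero =>
    refine Real.iSup_le (fun i => ?_) (hpos x)
    by_cases hi : i ∈ x.support
    · exact Finset.single_le_sum (f := fun k => |x k|) (fun _ _ => abs_nonneg _) hi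
    · simp only [Finsupp.mem_support_iff, not_not] at hi
      simpa [hi] using hpos x
  | succ k ih =>
    refine max_le (ih x) (Real.sSup_le ?_ (hpos x))
    rintro _ ⟨d, E, hE, rfl⟩
    calc θ * ∑ i, tsirelsonNormAux θ F k (coordProj (E i) x)
        ≤ 1 * ∑ i, tsirelsonNormAux θ F k (coordProj (E i) x) :=
          mul_le_mul_of_nonneg_right h1
            (Finset.sum_nonneg fun _ _ => tsirelsonNormAux_nonneg _ _)
      _ ≤ ∑ i, ∑ j ∈ (coordProj (E i) x).support, |coordProj (E i) x j| := by
          rw [one_mul]; exact Finset.sum_le_sum fun i _ => ih _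
      _ ≤ _ := sum_coordProj_le hE x

theorem bddAbove_tsirelsonNormAux_step (h1 : θ ≤ 1) (k : ℕ) (x : ℕ+ →₀ ℝ) :
    BddAbove {r : ℝ | ∃ (d : ℕ) (E : Fin d → Finset ℕ+), IsAdmissible F E ∧
      r = θ * ∑ i, tsirelsonNormAux θ F k (coordProj (E i) x)} := by
  refine ⟨∑ j ∈ x.support, |x j|, ?_⟩
  rintro _ ⟨d, E, hE, rfl⟩
  calc θ * ∑ i, tsirelsonNormAux θ F k (coordProj (E i) x)
      ≤ 1 * ∑ i, tsirelsonNormAux θ F k (coordProj (E i) x) :=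
        mul_le_mul_of_nonneg_right h1
          (Finset.sum_nonneg fun _ _ => tsirelsonNormAux_nonneg _ _)
    _ ≤ ∑ i, ∑ j ∈ (coordProj (E i) x).support, |coordProj (E i) x j| := by
        rw [one_mul]; exact Finset.sum_le_sum fun i _ => tsirelsonNormAux_le_sum h1 _ _
    _ ≤ _ := sum_coordProj_le hE x

theorem bddAbove_tsirelsonNormAux (h1 : θ ≤ 1) (x : ℕ+ →₀ ℝ) :
    BddAbove (Set.range fun k => tsirelsonNormAux θ F k x) :=
  ⟨_, by rintro _ ⟨k, rfl⟩; exact tsirelsonNormAux_le_sum h1 k x⟩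

theorem tsirelsonNormAux_add_le (h0 : 0 ≤ θ) (h1 : θ ≤ 1) (k : ℕ) (x y : ℕ+ →₀ ℝ) :
    tsirelsonNormAux θ F k (x + y) ≤ tsirelsonNormAux θ F k x + tsirelsonNormAux θ F k y := by
  induction k generalizing x y with
  | zero =>
    refine ciSup_le fun i => ?_
    exact (abs_add_le (x i) (y i)).trans
      (add_le_add (le_ciSup (bddAbove_abs_coord x) i) (le_ciSup (bddAbove_abs_coord y) i))
  | succ k ih =>
    refine max_le ((ih x y).trans (add_le_add (le_max_left _ _) (le_max_left _ _)))
      (Real.sSup_le ?_ (add_nonneg (tsirelsonNormAux_nonneg _ _) (tsirelsonNormAux_nonneg _ _)))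
    rintro _ ⟨d, E, hE, rfl⟩
    calc θ * ∑ i, tsirelsonNormAux θ F k (coordProj (E i) (x + y))
        ≤ θ * ∑ i, (tsirelsonNormAux θ F k (coordProj (E i) x)
            + tsirelsonNormAux θ F k (coordProj (E i) y)) := by
          refine mul_le_mul_of_nonneg_left (Finset.sum_le_sum fun i _ => ?_) h0
          rw [coordProj_add]; exact ih _ _
      _ = θ * ∑ i, tsirelsonNormAux θ F k (coordProj (E i) x)
            + θ * ∑ i, tsirelsonNormAux θ F k (coordProj (E i) y) := by
          rw [Finset.sum_add_distrib, mul_add]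
      _ ≤ _ := add_le_add
          ((le_csSup (bddAbove_tsirelsonNormAux_step h1 k x) ⟨d, E, hE, rfl⟩).trans
            (le_max_right _ _))
          ((le_csSup (bddAbove_tsirelsonNormAux_step h1 k y) ⟨d, E, hE, rfl⟩).trans
            (le_max_right _ _))

theorem tsirelsonNormAux_smul_le (h0 : 0 ≤ θ) (h1 : θ ≤ 1) (k : ℕ) (c : ℝ) (x : ℕ+ →₀ ℝ) :
    tsirelsonNormAux θ F k (c • x) ≤ |c| * tsirelsonNormAux θ F k x := by
  induction k generalizing x with
  | zero =>
    refine ciSup_le fun i => ?_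
    rw [Finsupp.smul_apply, smul_eq_mul, abs_mul]
    exact mul_le_mul_of_nonneg_left (le_ciSup (bddAbove_abs_coord x) i) (abs_nonneg c)
  | succ k ih =>
    refine max_le ((ih x).trans (mul_le_mul_of_nonneg_left (le_max_left _ _) (abs_nonneg c)))
      (Real.sSup_le ?_ (mul_nonneg (abs_nonneg c) (tsirelsonNormAux_nonneg _ _)))
    rintro _ ⟨d, E, hE, rfl⟩
    calc θ * ∑ i, tsirelsonNormAux θ F k (coordProj (E i) (c • x))
        ≤ θ * ∑ i, |c| * tsirelsonNormAux θ F k (coordProj (E i) x) := by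
          refine mul_le_mul_of_nonneg_left (Finset.sum_le_sum fun i _ => ?_) h0
          rw [coordProj_smul]; exact ih _
      _ = |c| * (θ * ∑ i, tsirelsonNormAux θ F k (coordProj (E i) x)) := by
          rw [← Finset.mul_sum]; ring
      _ ≤ _ := mul_le_mul_of_nonneg_left
          ((le_csSup (bddAbove_tsirelsonNormAux_step h1 k x) ⟨d, E, hE, rfl⟩).trans
            (le_max_right _ _)) (abs_nonneg c)

theorem tsirelsonNorm_nonneg (x : ℕ+ →₀ ℝ) : 0 ≤ tsirelsonNorm θ F x :=
  Real.iSup_nonneg fun k => tsirelsonNormAux_nonneg k x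

theorem tsirelsonNorm_add_le (h0 : 0 ≤ θ) (h1 : θ ≤ 1) (x y : ℕ+ →₀ ℝ) :
    tsirelsonNorm θ F (x + y) ≤ tsirelsonNorm θ F x + tsirelsonNorm θ F y :=
  ciSup_le fun k => (tsirelsonNormAux_add_le h0 h1 k x y).trans
    (add_le_add (le_ciSup (bddAbove_tsirelsonNormAux h1 x) k)
      (le_ciSup (bddAbove_tsirelsonNormAux h1 y) k))

theorem tsirelsonNorm_smul_le (h0 : 0 ≤ θ) (h1 : θ ≤ 1) (c : ℝ) (x : ℕ+ →₀ ℝ) :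
    tsirelsonNorm θ F (c • x) ≤ |c| * tsirelsonNorm θ F x :=
  ciSup_le fun k => (tsirelsonNormAux_smul_le h0 h1 k c x).trans
    (mul_le_mul_of_nonneg_left (le_ciSup (bddAbove_tsirelsonNormAux h1 x) k) (abs_nonneg c))

theorem abs_coord_le_tsirelsonNorm (h1 : θ ≤ 1) (x : ℕ+ →₀ ℝ) (i : ℕ+) :
    |x i| ≤ tsirelsonNorm θ F x :=
  (le_ciSup (bddAbove_abs_coord x) i).trans (le_ciSup (bddAbove_tsirelsonNormAux h1 x) 0)

end TsirelsonNormFacts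

/-- The vector space `c₀₀` of finitely supported real sequences indexed by the positive integers,
to be normed by `tsirelsonNorm θ F`. -/
def TsirelsonC00 (_θ : Set.Ioo (0 : ℝ) 1) (_F : Set (Finset ℕ+)) : Type := ℕ+ →₀ ℝ

noncomputable instance (θ : Set.Ioo (0 : ℝ) 1) (F : Set (Finset ℕ+)) :
    AddCommGroup (TsirelsonC00 θ F) :=
  inferInstanceAs (AddCommGroup (ℕ+ →₀ ℝ))

noncomputable instance (θ : Set.Ioo (0 : ℝ) 1) (F : Set (Finset ℕ+)) :
    Module ℝ (TsirelsonC00 θ F) :=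
  inferInstanceAs (Module ℝ (ℕ+ →₀ ℝ))

/-- `tsirelsonNorm θ F` as a group norm on `c₀₀`. -/
noncomputable def tsirelsonGroupNorm (θ : Set.Ioo (0 : ℝ) 1) (F : Set (Finset ℕ+)) :
    AddGroupNorm (TsirelsonC00 θ F) where
  toFun x := tsirelsonNorm θ F x
  map_zero' := by
    refine le_antisymm ?_ (tsirelsonNorm_nonneg _)
    have h := tsirelsonNorm_smul_le (F := F) θ.2.1.le θ.2.2.le 0 (0 : ℕ+ →₀ ℝ)
    rw [zero_smul, abs_zero, zero_mul] at h
    exact h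
  add_le' x y := tsirelsonNorm_add_le θ.2.1.le θ.2.2.le x y
  neg' x := by
    have key : ∀ y : ℕ+ →₀ ℝ, tsirelsonNorm θ F (-y) ≤ tsirelsonNorm θ F y := fun y => by
      simpa using tsirelsonNorm_smul_le (F := F) θ.2.1.le θ.2.2.le (-1) y
    have key' : ∀ y : ℕ+ →₀ ℝ, tsirelsonNorm θ F y ≤ tsirelsonNorm θ F (-y) := fun y => by
      simpa using key (-y)
    exact le_antisymm (key x) (key' x)
  eq_zero_of_map_eq_zero' x hx := by
    refine Finsupp.ext fun i => ?_
    exact abs_nonpos_iff.1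
      ((abs_coord_le_tsirelsonNorm (F := F) θ.2.2.le (x : ℕ+ →₀ ℝ) i).trans hx.le)

noncomputable instance (θ : Set.Ioo (0 : ℝ) 1) (F : Set (Finset ℕ+)) :
    NormedAddCommGroup (TsirelsonC00 θ F) :=
  (tsirelsonGroupNorm θ F).toNormedAddCommGroup

noncomputable instance (θ : Set.Ioo (0 : ℝ) 1) (F : Set (Finset ℕ+)) :
    NormedSpace ℝ (TsirelsonC00 θ F) where
  norm_smul_le c x := tsirelsonNorm_smul_le θ.2.1.le θ.2.2.le c x

theorem TsirelsonC00.norm_def (θ : Set.Ioo (0 : ℝ) 1) (F : Set (Finset ℕ+))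
    (x : TsirelsonC00 θ F) : ‖x‖ = tsirelsonNorm θ F x := rfl

/-- The Tsirelson-type Banach space `T[θ, F]`: the completion of `c₀₀` in `tsirelsonNorm θ F`. -/
abbrev TsirelsonSpace (θ : Set.Ioo (0 : ℝ) 1) (F : Set (Finset ℕ+)) : Type :=
  UniformSpace.Completion (TsirelsonC00 θ F)

theorem one_div_mem_Ioo {n : ℕ} (hn : 2 ≤ n) : (1 / n : ℝ) ∈ Set.Ioo (0 : ℝ) 1 := by
  have h : (2 : ℝ) ≤ n := by exact_mod_cast hn
  constructor
  · positivity
  · rw [div_lt_one (by linarith)]; linarith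

/-! Write θ = 1/n ≤ 1/2. The core claim is that U maps the span of e_1, …, e_m into itself whenever
θm ≥ 1 (`map_mem_initialSubspace`). An injective endomorphism of a finite-dimensional space is onto,
so the range of U contains c₀₀; being closed, it is everything.

The claim compares m late vectors with m + 1. Let x live on [1, m], let S consist of m later
indices, and let t ≥ m‖x‖₁. Then ‖x + t Σ_{k∈S} e_k‖ ≤ θmt (`tsirelsonNorm_add_smul_basisSum_le`):
an admissible family that sees x has a set meeting [1, m], hence at most m sets, and cannot also
exploit all of S. On the other side, let the indices in S be sparse. The images U e_k are then
almost successive blocks, by weak nullness of the basis. If Ux had a part of size ρ beyond m, that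
part and the m blocks would be m + 1 admissible pieces, since all their indices exceed m
(`mul_add_sum_le_tsirelsonNorm`). The image would have norm at least about θ(ρ + mt), which
contradicts isometry.

Weak nullness (`exists_forall_map_single_lt`) comes from averaging: if g(e_k) ≥ δ infinitely often,
repeated averages of blocks keep g ≥ δ while their norms decrease geometrically. -/

/-! ### The implicit norm equation and elementary estimates. -/

section NormFacts

variable {θ : ℝ} {F : Set (Finset ℕ+)}

/-- Successive nonempty sets have distinct minima, so the set of minima has exactly `d` elements.
The case `d = 0` corresponds to the empty member of the family. -/
theorem isAdmissible_schreierFamily_iff {d : ℕ} {E : Fin d → Finset ℕ+} :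
    IsAdmissible schreierFamily E ↔ (∀ i j, i < j → ∀ a ∈ E i, ∀ b ∈ E j, a < b) ∧
      (∀ i, (E i).Nonempty) ∧ ∀ i, ∀ a ∈ E i, d ≤ (a : ℕ) := by
  have hcard : (∀ i j, i < j → ∀ a ∈ E i, ∀ b ∈ E j, a < b) → ∀ h : ∀ i, (E i).Nonempty,
      (Finset.univ.image fun i => (E i).min' (h i)).card = d := by
    intro hE h
    rw [Finset.card_image_of_injective, Finset.card_univ, Fintype.card_fin]
    have hm : StrictMono fun i => (E i).min' (h i) := fun i j hij =>
      hE i j hij _ (Finset.min'_mem _ _) _ (Finset.min'_mem _ _)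
    exact hm.injective
  constructor
  · rintro ⟨hE, h, hF⟩
    refine ⟨hE, h, fun i a ha => ?_⟩
    rcases hF with hF | ⟨hne, hF⟩
    · rw [Finset.image_eq_empty] at hF
      exact absurd (Finset.mem_univ i) (by rw [hF]; simp)
    · rw [hcard hE h] at hF
      refine hF.trans ?_
      have h1 : (Finset.univ.image fun i => (E i).min' (h i)).min' hne ≤ (E i).min' (h i) :=
        Finset.min'_le _ _ (Finset.mem_image_of_mem _ (Finset.mem_univ i))
      exact_mod_cast h1.trans (Finset.min'_le _ _ ha)
  · rintro ⟨hE, h, hd⟩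
    refine ⟨hE, h, ?_⟩
    by_cases hne : (Finset.univ.image fun i => (E i).min' (h i)).Nonempty
    · refine Or.inr ⟨hne, ?_⟩
      rw [hcard hE h]
      obtain ⟨i, -, hi⟩ := Finset.mem_image.1 (Finset.min'_mem _ hne)
      rw [← hi]
      exact hd i _ (Finset.min'_mem _ _)
    · exact Or.inl (Finset.not_nonempty_iff_eq_empty.1 hne)

theorem tsirelsonNormAux_le_tsirelsonNorm (h1 : θ ≤ 1) (k : ℕ) (x : ℕ+ →₀ ℝ) :
    tsirelsonNormAux θ F k x ≤ tsirelsonNorm θ F x :=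
  le_ciSup (bddAbove_tsirelsonNormAux h1 x) k

theorem monotone_tsirelsonNormAux (x : ℕ+ →₀ ℝ) :
    Monotone fun k => tsirelsonNormAux θ F k x :=
  monotone_nat_of_le_succ fun _ => le_max_left _ _

theorem tsirelsonNorm_le_sum (h1 : θ ≤ 1) (x : ℕ+ →₀ ℝ) :
    tsirelsonNorm θ F x ≤ ∑ j ∈ x.support, |x j| :=
  ciSup_le fun k => tsirelsonNormAux_le_sum h1 k x

/-- Limit in `k` of the inequality defining ‖·‖_{k+1}. With `tsirelsonNorm_le_of_forall` it replaces
the inductive definition by the implicit Tsirelson equation. -/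
theorem mul_sum_tsirelsonNorm_coordProj_le (h1 : θ ≤ 1) {d : ℕ}
    {E : Fin d → Finset ℕ+} (hE : IsAdmissible F E) (x : ℕ+ →₀ ℝ) :
    θ * ∑ i, tsirelsonNorm θ F (coordProj (E i) x) ≤ tsirelsonNorm θ F x := by
  have hlim : Filter.Tendsto
      (fun k => θ * ∑ i, tsirelsonNormAux θ F k (coordProj (E i) x)) Filter.atTop
      (nhds (θ * ∑ i, tsirelsonNorm θ F (coordProj (E i) x))) :=
    Filter.Tendsto.const_mul _ (tendsto_finsetSum _ fun i _ =>
      tendsto_atTop_ciSup (monotone_tsirelsonNormAux _) (bddAbove_tsirelsonNormAux h1 _))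
  refine le_of_tendsto' hlim fun k => ?_
  refine le_trans ?_ (tsirelsonNormAux_le_tsirelsonNorm h1 (k + 1) x)
  exact (le_csSup (bddAbove_tsirelsonNormAux_step h1 k x) ⟨d, E, hE, rfl⟩).trans
    (le_max_right _ _)

theorem tsirelsonNorm_le_of_forall (h0 : 0 ≤ θ) (h1 : θ ≤ 1) {x : ℕ+ →₀ ℝ} {C : ℝ}
    (hx : ∀ i, |x i| ≤ C)
    (hE : ∀ (d : ℕ) (E : Fin d → Finset ℕ+), IsAdmissible F E →
      θ * ∑ i, tsirelsonNorm θ F (coordProj (E i) x) ≤ C) :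
    tsirelsonNorm θ F x ≤ C := by
  have hC : 0 ≤ C := (abs_nonneg _).trans (hx 1)
  refine ciSup_le fun k => ?_
  induction k with
  | zero => exact ciSup_le hx
  | succ k ih =>
    refine max_le ih (Real.sSup_le ?_ hC)
    rintro _ ⟨d, E, hE', rfl⟩
    refine le_trans ?_ (hE d E hE')
    exact mul_le_mul_of_nonneg_left
      (Finset.sum_le_sum fun i _ => tsirelsonNormAux_le_tsirelsonNorm h1 k _) h0

theorem coordProj_coordProj_comm (A B : Finset ℕ+) (x : ℕ+ →₀ ℝ) :
    coordProj A (coordProj B x) = coordProj B (coordProj A x) := by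
  ext i
  simp only [coordProj_apply]
  split_ifs <;> rfl

theorem abs_coordProj_le (A : Finset ℕ+) (x : ℕ+ →₀ ℝ) (i : ℕ+) :
    |coordProj A x i| ≤ |x i| := by
  rw [coordProj_apply]
  split_ifs <;> simp

theorem coordProj_sum {ι : Type*} (A : Finset ℕ+) (s : Finset ι) (f : ι → ℕ+ →₀ ℝ) :
    coordProj A (∑ i ∈ s, f i) = ∑ i ∈ s, coordProj A (f i) :=
  Finsupp.filter_sum _ _

theorem coordProj_eq_self {A : Finset ℕ+} {x : ℕ+ →₀ ℝ} (h : x.support ⊆ A) :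
    coordProj A x = x := by
  ext i
  rw [coordProj_apply]
  split_ifs with hi
  · rfl
  · by_contra h'
    exact hi (h (Finsupp.mem_support_iff.2 (Ne.symm h')))

theorem coordProj_eq_zero {A : Finset ℕ+} {x : ℕ+ →₀ ℝ} (h : ∀ i ∈ x.support, i ∉ A) :
    coordProj A x = 0 := by
  ext i
  rw [coordProj_apply]
  split_ifs with hi
  · by_contra h'
    exact h i (Finsupp.mem_support_iff.2 h') hi
  · rfl

theorem tsirelsonNorm_zero (h1 : θ ≤ 1) : tsirelsonNorm θ F 0 = 0 :=
  le_antisymm (by simpa using tsirelsonNorm_le_sum (F := F) h1 0) (tsirelsonNorm_nonneg _)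

theorem tsirelsonNorm_smul (h0 : 0 ≤ θ) (h1 : θ ≤ 1) (c : ℝ) (x : ℕ+ →₀ ℝ) :
    tsirelsonNorm θ F (c • x) = |c| * tsirelsonNorm θ F x := by
  refine le_antisymm (tsirelsonNorm_smul_le h0 h1 c x) ?_
  rcases eq_or_ne c 0 with rfl | hc
  · simpa using tsirelsonNorm_nonneg _
  · have h := tsirelsonNorm_smul_le (F := F) h0 h1 c⁻¹ (c • x)
    rw [smul_smul, inv_mul_cancel₀ hc, one_smul, abs_inv] at h
    have hc' : 0 < |c| := abs_pos.2 hc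
    calc |c| * tsirelsonNorm θ F x ≤ |c| * (|c|⁻¹ * tsirelsonNorm θ F (c • x)) :=
          mul_le_mul_of_nonneg_left h hc'.le
      _ = _ := by field_simp

theorem tsirelsonNorm_sum_le {ι : Type*} (h0 : 0 ≤ θ) (h1 : θ ≤ 1) (s : Finset ι)
    (f : ι → ℕ+ →₀ ℝ) :
    tsirelsonNorm θ F (∑ i ∈ s, f i) ≤ ∑ i ∈ s, tsirelsonNorm θ F (f i) :=
  Finset.le_sum_of_subadditive _ (tsirelsonNorm_zero h1).le (tsirelsonNorm_add_le h0 h1) s f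

theorem tsirelsonNorm_coordProj_le (h0 : 0 ≤ θ) (h1 : θ ≤ 1) (A : Finset ℕ+) (x : ℕ+ →₀ ℝ) :
    tsirelsonNorm θ F (coordProj A x) ≤ tsirelsonNorm θ F x := by
  suffices h : ∀ k x, tsirelsonNormAux θ F k (coordProj A x) ≤ tsirelsonNormAux θ F k x from
    ciSup_le fun k => (h k x).trans (tsirelsonNormAux_le_tsirelsonNorm h1 k x)
  intro k
  induction k with
  | zero =>
    intro x
    exact ciSup_le fun i => (abs_coordProj_le A x i).trans (le_ciSup (bddAbove_abs_coord x) i)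
  | succ k ih =>
    intro x
    refine max_le ((ih x).trans (le_max_left _ _))
      (Real.sSup_le ?_ (tsirelsonNormAux_nonneg _ _))
    rintro _ ⟨d, E, hE, rfl⟩
    calc θ * ∑ i, tsirelsonNormAux θ F k (coordProj (E i) (coordProj A x))
        ≤ θ * ∑ i, tsirelsonNormAux θ F k (coordProj (E i) x) := by
          refine mul_le_mul_of_nonneg_left (Finset.sum_le_sum fun i _ => ?_) h0
          rw [coordProj_coordProj_comm]
          exact ih _
      _ ≤ _ := (le_csSup (bddAbove_tsirelsonNormAux_step h1 k x) ⟨d, E, hE, rfl⟩).trans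
          (le_max_right _ _)

/-- The pieces of an admissible family have total norm at most ‖x‖₁, so only the outermost factor θ
is kept. -/
theorem tsirelsonNorm_le_max (h0 : 0 ≤ θ) (h1 : θ ≤ 1) {x : ℕ+ →₀ ℝ} {C : ℝ}
    (hx : ∀ i, |x i| ≤ C) (hC : θ * ∑ i ∈ x.support, |x i| ≤ C) :
    tsirelsonNorm θ F x ≤ C := by
  refine tsirelsonNorm_le_of_forall h0 h1 hx fun d E hE => le_trans ?_ hC
  refine mul_le_mul_of_nonneg_left ?_ h0
  exact (Finset.sum_le_sum fun i _ => tsirelsonNorm_le_sum h1 _).trans (sum_coordProj_le hE x)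

/-- The norms of the restrictions of `x` to pairwise separated sets add up to at most the `ℓ₁`-norm
of `x`. -/
theorem sum_tsirelsonNorm_coordProj_le_sum (h1 : θ ≤ 1) {d : ℕ} {E : Fin d → Finset ℕ+}
    (hE : ∀ i j, i < j → ∀ a ∈ E i, ∀ b ∈ E j, a < b) (x : ℕ+ →₀ ℝ) :
    ∑ i, tsirelsonNorm θ F (coordProj (E i) x) ≤ ∑ k ∈ x.support, |x k| := by
  refine (Finset.sum_le_sum fun i _ => tsirelsonNorm_le_sum h1 _).trans ?_
  have h1 : ∀ i, ∑ k ∈ (coordProj (E i) x).support, |coordProj (E i) x k|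
      = ∑ k ∈ x.support, if k ∈ E i then |x k| else 0 := by
    intro i
    rw [Finset.sum_subset (s₂ := x.support)]
    · refine Finset.sum_congr rfl fun k _ => ?_
      rw [coordProj_apply]
      split_ifs <;> simp
    · intro k hk
      rw [Finsupp.mem_support_iff, coordProj_apply] at hk
      rw [Finsupp.mem_support_iff]
      intro h0
      simp [h0] at hk
    · intro k _ hk
      simpa using hk
  simp_rw [h1]
  rw [Finset.sum_comm]
  refine Finset.sum_le_sum fun k _ => ?_
  by_cases hk : ∃ i, k ∈ E i
  · obtain ⟨i, hi⟩ := hk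
    rw [Finset.sum_eq_single i]
    · simp [hi]
    · intro j _ hj
      rw [if_neg]
      intro hkj
      rcases lt_or_gt_of_ne hj with h | h
      · exact lt_irrefl _ (hE j i h k hkj k hi)
      · exact lt_irrefl _ (hE i j h k hi k hkj)
    · simp
  · push Not at hk
    simp [hk]

theorem sum_abs_coordProj_le (A : Finset ℕ+) (x : ℕ+ →₀ ℝ) :
    ∑ k ∈ (coordProj A x).support, |coordProj A x k| ≤ ∑ k ∈ x.support, |x k| := by
  refine (Finset.sum_le_sum fun k _ => abs_coordProj_le A x k).trans ?_
  refine Finset.sum_le_sum_of_subset_of_nonneg ?_ fun _ _ _ => abs_nonneg _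
  intro k hk
  rw [Finsupp.mem_support_iff, coordProj_apply] at hk
  rw [Finsupp.mem_support_iff]
  exact fun h => hk (by simp [h])

theorem tsirelsonNorm_single (h1 : θ ≤ 1) (k : ℕ+) :
    tsirelsonNorm θ F (Finsupp.single k 1) = 1 := by
  refine le_antisymm ?_ ?_
  · refine (tsirelsonNorm_le_sum h1 _).trans ?_
    rw [Finsupp.support_single (hb := one_ne_zero)]
    simp
  · simpa using abs_coord_le_tsirelsonNorm (F := F) h1 (Finsupp.single k 1) k

end NormFacts

/-! ### Sums of basis vectors and the upper estimate. -/

section BlockSums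

variable {θ : ℝ} {F : Set (Finset ℕ+)}

theorem sum_abs_support_eq {x : ℕ+ →₀ ℝ} {s : Finset ℕ+} (h : x.support ⊆ s) :
    ∑ k ∈ x.support, |x k| = ∑ k ∈ s, |x k| :=
  Finset.sum_subset h fun k _ hk => by simpa using hk

theorem sum_abs_add_le (x y : ℕ+ →₀ ℝ) :
    ∑ k ∈ (x + y).support, |(x + y) k| ≤ ∑ k ∈ x.support, |x k| + ∑ k ∈ y.support, |y k| := by
  classical
  rw [sum_abs_support_eq (Finsupp.support_add (g₁ := x) (g₂ := y)),
    sum_abs_support_eq (Finset.subset_union_left (s₁ := x.support) (s₂ := y.support)),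
    sum_abs_support_eq (Finset.subset_union_right (s₁ := x.support) (s₂ := y.support)),
    ← Finset.sum_add_distrib]
  exact Finset.sum_le_sum fun k _ => abs_add_le _ _

theorem sum_abs_smul_le (c : ℝ) (x : ℕ+ →₀ ℝ) :
    ∑ k ∈ (c • x).support, |(c • x) k| ≤ |c| * ∑ k ∈ x.support, |x k| := by
  rw [sum_abs_support_eq (Finsupp.support_smul (b := c) (g := x)), Finset.mul_sum]
  exact Finset.sum_le_sum fun k _ => by simp [abs_mul]

theorem sum_abs_sum_le {ι : Type*} (s : Finset ι) (f : ι → ℕ+ →₀ ℝ) :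
    ∑ k ∈ (∑ i ∈ s, f i).support, |(∑ i ∈ s, f i) k| ≤ ∑ i ∈ s, ∑ k ∈ (f i).support, |f i k| :=
  Finset.le_sum_of_subadditive (fun x : ℕ+ →₀ ℝ => ∑ k ∈ x.support, |x k|) (by simp)
    sum_abs_add_le s f

/-- The sum of the basis vectors with index in `S`. -/
noncomputable def basisSum (S : Finset ℕ+) : ℕ+ →₀ ℝ := ∑ k ∈ S, Finsupp.single k 1

theorem basisSum_apply (S : Finset ℕ+) (i : ℕ+) :
    basisSum S i = if i ∈ S then 1 else 0 := by
  classical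
  simp [basisSum, Finsupp.finsetSum_apply, Finsupp.single_apply]

theorem support_basisSum (S : Finset ℕ+) : (basisSum S).support = S := by
  ext i
  simp [basisSum_apply]

theorem sum_abs_basisSum (S : Finset ℕ+) :
    ∑ k ∈ (basisSum S).support, |basisSum S k| = S.card := by
  rw [support_basisSum, Finset.sum_congr rfl (g := fun _ => (1 : ℝ))]
  · simp
  · intro k hk
    simp [basisSum_apply, hk]

theorem coordProj_basisSum (A S : Finset ℕ+) :
    coordProj A (basisSum S) = basisSum (S ∩ A) := by
  ext i
  simp only [coordProj_apply, basisSum_apply, Finset.mem_inter]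
  split_ifs <;> simp_all

/-- For card S ≥ 2, θ card S ≤ card S / 2 ≤ card S - 1. The unit gained over the ℓ₁ bound later
absorbs the contribution of `x`. -/
theorem tsirelsonNorm_basisSum_le (h0 : 0 ≤ θ) (h2 : θ ≤ 1 / 2) {S : Finset ℕ+}
    (hS : 2 ≤ S.card) : tsirelsonNorm θ F (basisSum S) ≤ S.card - 1 := by
  have hS' : (2 : ℝ) ≤ S.card := by exact_mod_cast hS
  refine tsirelsonNorm_le_max h0 (by linarith) (fun i => ?_) ?_
  · rw [basisSum_apply]
    split_ifs
    · rw [abs_one]; linarith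
    · rw [abs_zero]; linarith
  · rw [sum_abs_basisSum]
    nlinarith

/-- The coordinates are at most t and the ℓ₁ norm is at most 2t, which θ ≤ 1/2 brings back to t. -/
theorem tsirelsonNorm_add_smul_basisSum_le_of_card_le_one (h0 : 0 ≤ θ) (h2 : θ ≤ 1 / 2)
    {x : ℕ+ →₀ ℝ} {S : Finset ℕ+} (hS : S.card ≤ 1) (hx : ∀ i ∈ S, x i = 0) {t : ℝ}
    (ht : ∑ k ∈ x.support, |x k| ≤ t) : tsirelsonNorm θ F (x + t • basisSum S) ≤ t := by
  have h1 : θ ≤ 1 := by linarith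
  have ht0 : 0 ≤ t := le_trans (Finset.sum_nonneg fun _ _ => abs_nonneg _) ht
  have hS' : (S.card : ℝ) ≤ 1 := by exact_mod_cast hS
  refine tsirelsonNorm_le_max h0 h1 (fun i => ?_) ?_
  · rw [Finsupp.add_apply, Finsupp.smul_apply, basisSum_apply]
    split_ifs with hi
    · simp [hx i hi, abs_of_nonneg ht0]
    · simpa using ((abs_coord_le_tsirelsonNorm (θ := 1) (F := F) le_rfl x i).trans
        (tsirelsonNorm_le_sum le_rfl x)).trans ht
  · have h := (sum_abs_add_le x (t • basisSum S)).trans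
      (add_le_add ht (sum_abs_smul_le t (basisSum S)))
    rw [sum_abs_basisSum, abs_of_nonneg ht0] at h
    have hnn : 0 ≤ ∑ k ∈ (x + t • basisSum S).support, |(x + t • basisSum S) k| :=
      Finset.sum_nonneg fun _ _ => abs_nonneg _
    nlinarith

theorem sum_card_inter_le {d : ℕ} {E : Fin d → Finset ℕ+}
    (hE : ∀ i j, i < j → ∀ a ∈ E i, ∀ b ∈ E j, a < b) (S : Finset ℕ+) :
    ∑ i, (S ∩ E i).card ≤ S.card := by
  rw [← Finset.card_biUnion]
  · refine Finset.card_le_card (Finset.biUnion_subset.2 fun i _ => Finset.inter_subset_left)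
  · intro i _ j _ hij
    refine Finset.disjoint_left.2 fun a ha hb => ?_
    rw [Finset.mem_inter] at ha hb
    rcases lt_or_gt_of_ne hij with h | h
    · exact lt_irrefl _ (hE i j h a ha.2 a hb.2)
    · exact lt_irrefl _ (hE j i h a hb.2 a ha.2)

/-- If `x` lives on the first `m` coordinates and `t` is large, then adding `x` to `t` times a sum of
`m` later basis vectors does not push the norm above `θ m t`. -/
theorem tsirelsonNorm_add_smul_basisSum_le (h0 : 0 ≤ θ) (h2 : θ ≤ 1 / 2) {m : ℕ+}
    (hm : 1 ≤ θ * (m : ℕ)) {x : ℕ+ →₀ ℝ} (hx : ∀ i ∈ x.support, i ≤ m) {S : Finset ℕ+}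
    (hS : ∀ k ∈ S, m < k) (hc : S.card = (m : ℕ)) {t : ℝ}
    (ht : (m : ℕ) * ∑ k ∈ x.support, |x k| ≤ t) :
    tsirelsonNorm θ schreierFamily (x + t • basisSum S) ≤ θ * ((m : ℕ) * t) := by
  have h1 : θ ≤ 1 := by linarith
  set X := ∑ k ∈ x.support, |x k| with hX
  have hX0 : 0 ≤ X := Finset.sum_nonneg fun _ _ => abs_nonneg _
  have hm1 : (1 : ℝ) ≤ (m : ℕ) := by exact_mod_cast m.pos
  have hXt : X ≤ t := by nlinarith
  have ht0 : 0 ≤ t := hX0.trans hXt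
  have hxS : ∀ i ∈ S, x i = 0 := fun i hi => by
    by_contra h
    exact absurd (hx i (Finsupp.mem_support_iff.2 h)) (not_le.2 (hS i hi))
  refine tsirelsonNorm_le_of_forall h0 h1 (fun i => ?_) fun d E hE => ?_
  -- The sup-norm part is where θm ≥ 1 is needed.
  · refine le_trans ?_ (by nlinarith : t ≤ θ * ((m : ℕ) * t))
    rw [Finsupp.add_apply, Finsupp.smul_apply, basisSum_apply]
    split_ifs with hi
    · simp [hxS i hi, abs_of_nonneg ht0]
    · simpa using ((abs_coord_le_tsirelsonNorm (θ := 1) (F := schreierFamily) le_rfl x i).trans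
        (tsirelsonNorm_le_sum le_rfl x)).trans hXt
  · refine mul_le_mul_of_nonneg_left ?_ h0
    rw [isAdmissible_schreierFamily_iff] at hE
    obtain ⟨hE, -, hd⟩ := hE
    simp only [coordProj_add, coordProj_smul]
    -- A set meeting [1, m] forces d ≤ m; otherwise `x` is invisible and the ℓ₁ bound mt suffices.
    by_cases hlow : ∃ i, ∃ a ∈ E i, a ≤ m
    · obtain ⟨i, a, ha, ham⟩ := hlow
      have hdm : d ≤ (m : ℕ) := (hd i a ha).trans (by exact_mod_cast ham)
      have hdm' : (d : ℝ) ≤ (m : ℕ) := by exact_mod_cast hdm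
      have hxE : ∀ i, ∑ k ∈ (coordProj (E i) x).support, |coordProj (E i) x k| ≤ X :=
        fun i => sum_abs_coordProj_le _ _
      simp only [coordProj_basisSum]
      -- Either each of the at most m pieces costs at most t, or some piece contains two points of S
      -- and saves t, which pays for the total contribution dX ≤ mX ≤ t of `x`.
      by_cases hsmall : ∀ i, (S ∩ E i).card ≤ 1
      · calc ∑ i, tsirelsonNorm θ schreierFamily
              (coordProj (E i) x + t • basisSum (S ∩ E i))
            ≤ ∑ _i : Fin d, t := Finset.sum_le_sum fun i _ =>
              tsirelsonNorm_add_smul_basisSum_le_of_card_le_one h0 h2 (hsmall i)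
                (fun k hk => by
                  have := abs_coordProj_le (E i) x k
                  rw [hxS k (Finset.mem_inter.1 hk).1, abs_zero] at this
                  exact abs_nonpos_iff.1 this) ((hxE i).trans hXt)
          _ = d * t := by simp
          _ ≤ _ := mul_le_mul_of_nonneg_right hdm' ht0
      · push Not at hsmall
        obtain ⟨i₀, hi₀⟩ := hsmall
        have hterm : ∀ i, tsirelsonNorm θ schreierFamily
            (coordProj (E i) x + t • basisSum (S ∩ E i))
            ≤ X + t * ((S ∩ E i).card - if i = i₀ then 1 else 0) := by
          intro i
          refine (tsirelsonNorm_add_le h0 h1 _ _).trans (add_le_add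
            ((tsirelsonNorm_le_sum h1 _).trans (hxE i)) ?_)
          rw [tsirelsonNorm_smul h0 h1, abs_of_nonneg ht0]
          refine mul_le_mul_of_nonneg_left ?_ ht0
          split_ifs with hi
          · subst hi
            exact tsirelsonNorm_basisSum_le h0 h2 hi₀
          · rw [sub_zero, ← sum_abs_basisSum]
            exact tsirelsonNorm_le_sum h1 _
        have hsum : (∑ i, (S ∩ E i).card : ℝ) ≤ (m : ℕ) := by
          rw [← hc]
          exact_mod_cast sum_card_inter_le hE S
        calc ∑ i, tsirelsonNorm θ schreierFamily
              (coordProj (E i) x + t • basisSum (S ∩ E i))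
            ≤ ∑ i, (X + t * ((S ∩ E i).card - if i = i₀ then 1 else 0)) :=
              Finset.sum_le_sum fun i _ => hterm i
          _ = d * X + t * (∑ i, ((S ∩ E i).card : ℝ) - 1) := by
              rw [Finset.sum_add_distrib, ← Finset.mul_sum, Finset.sum_sub_distrib]
              simp
          _ ≤ (m : ℕ) * t := by nlinarith
    · push Not at hlow
      have hz : ∀ i, coordProj (E i) x = 0 := fun i =>
        coordProj_eq_zero fun k hk hkE => absurd (hx k hk) (not_le.2 (hlow i k hkE))
      simp only [hz, zero_add, tsirelsonNorm_smul h0 h1, abs_of_nonneg ht0]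
      rw [← Finset.mul_sum, mul_comm]
      refine mul_le_mul_of_nonneg_right ?_ ht0
      rw [← hc, ← sum_abs_basisSum]
      exact sum_tsirelsonNorm_coordProj_le_sum h1 hE _

end BlockSums

/-! ### Weak nullness of the basis by repeated averaging. -/

section WeakNull

variable {θ : ℝ}

theorem exists_block_sequence {α : Type*} (p : ℕ+ → α → Prop) (supp : α → Finset ℕ+)
    (h : ∀ K, ∃ a, p K a ∧ ∀ i ∈ supp a, K < i) (K₀ : ℕ+) :
    ∃ (K : ℕ → ℕ+) (a : ℕ → α), K 0 = K₀ ∧ StrictMono K ∧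
      ∀ j, p (K j) (a j) ∧ ∀ i ∈ supp (a j), K j < i ∧ i ≤ K (j + 1) := by
  choose f hf using h
  -- Inserting K + 1 keeps the cut points strictly increasing even when the support is empty.
  let next : ℕ+ → ℕ+ := fun K => (insert (K + 1) (supp (f K))).max' (Finset.insert_nonempty _ _)
  let K : ℕ → ℕ+ := fun j => Nat.rec K₀ (fun _ K => next K) j
  refine ⟨K, fun j => f (K j), rfl, strictMono_nat_of_lt_succ fun j => ?_, fun j =>
    ⟨(hf _).1, fun i hi => ⟨(hf _).2 i hi, ?_⟩⟩⟩
  · exact (PNat.lt_add_right (K j) 1).trans_le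
      (Finset.le_max' _ _ (Finset.mem_insert_self _ _))
  · exact Finset.le_max' _ _ (Finset.mem_insert_of_mem hi)

theorem sum_range_le_add_card {s : ℕ → ℝ} {c : ℝ} (hc : 0 ≤ c) (hs : ∀ j, s j ≤ 1) (D : ℕ) :
    ∑ j ∈ Finset.range D, s j ≤ D * c + ((Finset.range D).filter fun j => c < s j).card := by
  have h : ∀ j ∈ Finset.range D, s j ≤ c + if c < s j then 1 else 0 := fun j _ => by
    split_ifs with hj
    · linarith [hs j]
    · linarith
  refine (Finset.sum_le_sum h).trans_eq ?_
  rw [Finset.sum_add_distrib, Finset.sum_boole]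
  simp

/-- The average of the first `D` terms of a sequence of vectors. -/
noncomputable def blockAverage (a : ℕ → ℕ+ →₀ ℝ) (D : ℕ) : ℕ+ →₀ ℝ :=
  (D : ℝ)⁻¹ • ∑ j ∈ Finset.range D, a j

theorem sum_abs_blockAverage_le {a : ℕ → ℕ+ →₀ ℝ} (ha : ∀ j, ∑ k ∈ (a j).support, |a j k| ≤ 1)
    (D : ℕ) : ∑ k ∈ (blockAverage a D).support, |blockAverage a D k| ≤ 1 := by
  refine (sum_abs_smul_le _ _).trans ?_
  rw [abs_of_nonneg (by positivity)]
  calc (D : ℝ)⁻¹ * _ ≤ (D : ℝ)⁻¹ * D := by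
        refine mul_le_mul_of_nonneg_left ((sum_abs_sum_le _ _).trans ?_) (by positivity)
        exact (Finset.sum_le_sum fun j _ => ha j).trans (by simp)
    _ ≤ 1 := inv_mul_le_one

theorem lt_of_mem_support_blockAverage {a : ℕ → ℕ+ →₀ ℝ} {K : ℕ+}
    (ha : ∀ j, ∀ i ∈ (a j).support, K < i) (D : ℕ) :
    ∀ i ∈ (blockAverage a D).support, K < i := by
  classical
  intro i hi
  obtain ⟨j, -, hj⟩ := Finset.mem_biUnion.1 (Finsupp.support_finsetSum (Finsupp.support_smul hi))
  exact ha j i hj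

theorem le_map_blockAverage {a : ℕ → ℕ+ →₀ ℝ} {g : (ℕ+ →₀ ℝ) →ₗ[ℝ] ℝ} {δ : ℝ}
    (ha : ∀ j, δ ≤ g (a j)) {D : ℕ} (hD : 0 < D) : δ ≤ g (blockAverage a D) := by
  have hD' : (0 : ℝ) < D := by exact_mod_cast hD
  rw [blockAverage, map_smul, map_sum, smul_eq_mul, le_inv_mul_iff₀ hD']
  exact le_trans (by simp) (Finset.sum_le_sum fun j _ => ha j)

theorem sum_tsirelsonNorm_coordProj_blockAverage_le {F : Set (Finset ℕ+)} (h0 : 0 ≤ θ)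
    (h1 : θ ≤ 1) (a : ℕ → ℕ+ →₀ ℝ) (D : ℕ) {d : ℕ} (E : Fin d → Finset ℕ+) :
    ∑ i, tsirelsonNorm θ F (coordProj (E i) (blockAverage a D)) ≤
      (D : ℝ)⁻¹ * ∑ j ∈ Finset.range D, ∑ i, tsirelsonNorm θ F (coordProj (E i) (a j)) := by
  rw [Finset.sum_comm, Finset.mul_sum]
  refine Finset.sum_le_sum fun i _ => ?_
  rw [blockAverage, coordProj_smul, coordProj_sum, tsirelsonNorm_smul h0 h1,
    abs_of_nonneg (by positivity)]
  exact mul_le_mul_of_nonneg_left (tsirelsonNorm_sum_le h0 h1 _ _) (by positivity)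

/-- Arbitrarily far out there are vectors `a` in the `ℓ₁` ball with `g a ≥ δ` whose restrictions
to any `d` separated sets have norms adding up to at most `c`. -/
def HasSpreadVectors (θ : ℝ) (g : (ℕ+ →₀ ℝ) →ₗ[ℝ] ℝ) (δ c : ℝ) : Prop :=
  ∀ (K : ℕ+) (d : ℕ), ∃ a : ℕ+ →₀ ℝ, (∀ i ∈ a.support, K < i) ∧ ∑ k ∈ a.support, |a k| ≤ 1 ∧
    δ ≤ g a ∧ ∀ d' ≤ d, ∀ E : Fin d' → Finset ℕ+,
      (∀ i j, i < j → ∀ a ∈ E i, ∀ b ∈ E j, a < b) →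
        ∑ i, tsirelsonNorm θ schreierFamily (coordProj (E i) a) ≤ c

/-- Arbitrarily far out there are vectors `a` in the `ℓ₁` ball with `g a ≥ δ` and `‖a‖ ≤ c`. -/
def HasSmallVectors (θ : ℝ) (g : (ℕ+ →₀ ℝ) →ₗ[ℝ] ℝ) (δ c : ℝ) : Prop :=
  ∀ K : ℕ+, ∃ a : ℕ+ →₀ ℝ, (∀ i ∈ a.support, K < i) ∧ ∑ k ∈ a.support, |a k| ≤ 1 ∧
    δ ≤ g a ∧ tsirelsonNorm θ schreierFamily a ≤ c

variable {g : (ℕ+ →₀ ℝ) →ₗ[ℝ] ℝ} {δ c : ℝ}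

/-- Average successive blocks, each spread for families of at most K_j sets. For an admissible
family of d sets, blocks with K_j ≥ d contribute at most c, and blocks ending before d contribute
nothing because all sets lie in [d, ∞). Only one block can be exceptional, so the pieces sum to at
most c + 1/D ≤ 3c/2, and θ ≤ 1/2 gives 3c/4. -/
theorem HasSpreadVectors.hasSmallVectors (h0 : 0 ≤ θ) (h2 : θ ≤ 1 / 2) (hc : 0 < c)
    (h : HasSpreadVectors θ g δ c) : HasSmallVectors θ g δ (3 / 4 * c) := by
  have h1 : θ ≤ 1 := by linarith
  intro K₀
  obtain ⟨K, a, hK0, hK, ha⟩ := exists_block_sequence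
    (fun K (a : ℕ+ →₀ ℝ) => ∑ k ∈ a.support, |a k| ≤ 1 ∧
      δ ≤ g a ∧ ∀ d' ≤ (K : ℕ), ∀ E : Fin d' → Finset ℕ+,
        (∀ i j, i < j → ∀ a ∈ E i, ∀ b ∈ E j, a < b) →
          ∑ i, tsirelsonNorm θ schreierFamily (coordProj (E i) a) ≤ c)
    (fun a => a.support)
    (fun K => (h K K).imp fun a ha => ⟨ha.2, ha.1⟩) K₀
  obtain ⟨D, hD⟩ := exists_nat_gt (2 / c)
  have hDpos : (0 : ℝ) < D := lt_trans (by positivity) hD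
  have hDc : (D : ℝ)⁻¹ ≤ c / 2 := by
    rw [inv_le_comm₀ hDpos (by positivity), inv_div]
    exact hD.le
  refine ⟨blockAverage a D, lt_of_mem_support_blockAverage (fun j i hi => ?_) D,
    sum_abs_blockAverage_le (fun j => (ha j).1.1) D,
    le_map_blockAverage (fun j => (ha j).1.2.1) (by exact_mod_cast hDpos),
    tsirelsonNorm_le_of_forall h0 h1 (fun i => ?_) fun d E hE => ?_⟩
  · rw [← hK0]
    exact (hK.monotone (Nat.zero_le j)).trans_lt ((ha j).2 i hi).1
  · have habs : ∀ j, |a j i| ≤ 1 := fun j =>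
      ((abs_coord_le_tsirelsonNorm (θ := 1) (F := schreierFamily) le_rfl (a j) i).trans
        (tsirelsonNorm_le_sum le_rfl (a j))).trans (ha j).1.1
    -- The blocks are disjoint, so each coordinate of the average is at most 1/D.
    have huniq : ∀ j j', a j i ≠ 0 → a j' i ≠ 0 → ¬ j < j' := fun j j' hj hj' hlt => by
      have h3 := ((ha j).2 i (Finsupp.mem_support_iff.2 hj)).2
      have h4 := ((ha j').2 i (Finsupp.mem_support_iff.2 hj')).1
      exact absurd (h3.trans (hK.monotone hlt)) (not_le.2 h4)
    have hsum : |∑ j ∈ Finset.range D, a j i| ≤ 1 := by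
      by_cases hne : ∃ j ∈ Finset.range D, a j i ≠ 0
      · obtain ⟨j, hjD, hj⟩ := hne
        rw [Finset.sum_eq_single j (fun j' _ hj' => ?_) (fun h' => absurd hjD h')]
        · exact habs j
        · by_contra h'
          rcases lt_or_gt_of_ne hj' with hlt | hlt
          · exact huniq _ _ h' hj hlt
          · exact huniq _ _ hj h' hlt
      · push Not at hne
        rw [Finset.sum_eq_zero hne]
        simp
    rw [blockAverage, Finsupp.smul_apply, Finsupp.finsetSum_apply, smul_eq_mul, abs_mul,
      abs_of_nonneg (by positivity)]
    calc (D : ℝ)⁻¹ * _ ≤ (D : ℝ)⁻¹ * 1 := mul_le_mul_of_nonneg_left hsum (by positivity)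
      _ ≤ 3 / 4 * c := by linarith
  · rw [isAdmissible_schreierFamily_iff] at hE
    obtain ⟨hE, -, hd⟩ := hE
    set s : ℕ → ℝ := fun j => ∑ i, tsirelsonNorm θ schreierFamily (coordProj (E i) (a j)) with hs
    have hs1 : ∀ j, s j ≤ 1 := fun j =>
      (sum_tsirelsonNorm_coordProj_le_sum h1 hE (a j)).trans (ha j).1.1
    have hsc : ∀ j, c < s j → (K j : ℕ) < d ∧ d ≤ (K (j + 1) : ℕ) := by
      intro j hj
      refine ⟨not_le.1 fun hdK => absurd ((ha j).1.2.2 d hdK E hE) (not_le.2 hj), ?_⟩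
      by_contra hlt
      push Not at hlt
      refine absurd hj (not_lt.2 (le_trans (le_of_eq ?_) hc.le))
      refine Finset.sum_eq_zero fun i _ => ?_
      rw [coordProj_eq_zero fun k hk hkE => ?_, tsirelsonNorm_zero h1]
      have h3 : (k : ℕ) ≤ (K (j + 1) : ℕ) := by exact_mod_cast ((ha j).2 k hk).2
      exact absurd (hd i k hkE) (by omega)
    have huniq : ∀ j j', c < s j → c < s j' → ¬ j < j' := fun j j' hj hj' hlt => by
      have h3 : (K (j + 1) : ℕ) ≤ (K j' : ℕ) := by exact_mod_cast hK.monotone hlt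
      have h4 := hsc j hj
      have h5 := hsc j' hj'
      omega
    have hcard : (((Finset.range D).filter fun j => c < s j).card : ℝ) ≤ 1 := by
      have : ((Finset.range D).filter fun j => c < s j).card ≤ 1 := by
        refine Finset.card_le_one.2 fun j hj j' hj' => ?_
        have h3 := (Finset.mem_filter.1 hj).2
        have h4 := (Finset.mem_filter.1 hj').2
        exact le_antisymm (not_lt.1 (huniq _ _ h4 h3)) (not_lt.1 (huniq _ _ h3 h4))
      exact_mod_cast this
    have hbound := sum_tsirelsonNorm_coordProj_blockAverage_le (F := schreierFamily) h0 h1 a D E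
    have hsum := sum_range_le_add_card hc.le hs1 D
    have hfinal : ∑ i, tsirelsonNorm θ schreierFamily (coordProj (E i) (blockAverage a D))
        ≤ 3 / 2 * c := by
      refine hbound.trans ?_
      calc (D : ℝ)⁻¹ * ∑ j ∈ Finset.range D, s j ≤ (D : ℝ)⁻¹ * (D * c + 1) :=
            mul_le_mul_of_nonneg_left (by linarith) (by positivity)
        _ = c + (D : ℝ)⁻¹ := by field_simp
        _ ≤ _ := by linarith
    have hnn : 0 ≤ ∑ i, tsirelsonNorm θ schreierFamily (coordProj (E i) (blockAverage a D)) :=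
      Finset.sum_nonneg fun _ _ => tsirelsonNorm_nonneg _
    nlinarith

/-- In an average of D successive small blocks, a block meeting at most one of the sets contributes
at most its own norm, hence at most c. At most d blocks meet two sets, and they cost at most d/D ≤ η
in the average. -/
theorem HasSmallVectors.hasSpreadVectors (h0 : 0 ≤ θ) (h1 : θ ≤ 1) (hc : 0 ≤ c)
    (h : HasSmallVectors θ g δ c) {η : ℝ} (hη : 0 < η) : HasSpreadVectors θ g δ (c + η) := by
  intro K₀ d
  obtain ⟨K, a, hK0, hK, ha⟩ := exists_block_sequence
    (fun _ (a : ℕ+ →₀ ℝ) => ∑ k ∈ a.support, |a k| ≤ 1 ∧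
      δ ≤ g a ∧ tsirelsonNorm θ schreierFamily a ≤ c)
    (fun a => a.support)
    (fun K => (h K).imp fun a ha => ⟨ha.2, ha.1⟩) K₀
  obtain ⟨D, hD⟩ := exists_nat_gt (d / η)
  have hDpos : (0 : ℝ) < D := lt_of_le_of_lt (by positivity) hD
  have hDη : (D : ℝ)⁻¹ * d ≤ η := by
    rw [inv_mul_le_iff₀ hDpos]
    exact ((div_lt_iff₀ hη).1 hD).le
  refine ⟨blockAverage a D, lt_of_mem_support_blockAverage (fun j i hi => ?_) D,
    sum_abs_blockAverage_le (fun j => (ha j).1.1) D,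
    le_map_blockAverage (fun j => (ha j).1.2.1) (by exact_mod_cast hDpos), fun d' hd' E hE => ?_⟩
  · rw [← hK0]
    exact (hK.monotone (Nat.zero_le j)).trans_lt ((ha j).2 i hi).1
  set s : ℕ → ℝ := fun j => ∑ i, tsirelsonNorm θ schreierFamily (coordProj (E i) (a j)) with hs
  have hs1 : ∀ j, s j ≤ 1 := fun j =>
    (sum_tsirelsonNorm_coordProj_le_sum h1 hE (a j)).trans (ha j).1.1
  have htwo : ∀ j, c < s j → ∃ i i' : Fin d', i < i' ∧ (∃ k ∈ (a j).support, k ∈ E i) ∧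
      ∃ k ∈ (a j).support, k ∈ E i' := by
    intro j hj
    by_contra hcon
    push Not at hcon
    have hz : ∀ i, (∀ k ∈ (a j).support, k ∉ E i) →
        tsirelsonNorm θ schreierFamily (coordProj (E i) (a j)) = 0 := fun i hi => by
      rw [coordProj_eq_zero hi, tsirelsonNorm_zero h1]
    refine absurd hj (not_lt.2 ?_)
    by_cases hex : ∃ i, ∃ k ∈ (a j).support, k ∈ E i
    · obtain ⟨i, k, hk, hki⟩ := hex
      have hval : s j = tsirelsonNorm θ schreierFamily (coordProj (E i) (a j)) :=
        Finset.sum_eq_single i (fun i' _ hi' => hz i' fun k' hk' hki' => by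
          rcases lt_or_gt_of_ne hi' with hlt | hlt
          · exact hcon i' i hlt ⟨k', hk', hki'⟩ k hk hki
          · exact hcon i i' hlt ⟨k, hk, hki⟩ k' hk' hki') (by simp)
      rw [hval]
      exact (tsirelsonNorm_coordProj_le h0 h1 _ _).trans (ha j).1.2.2
    · push Not at hex
      exact (Finset.sum_eq_zero fun i _ => hz i (hex i)).trans_le hc
  -- Send an exceptional block to a set it meets that is followed by another set it meets. A later
  -- block cannot meet that same first set, so the assignment is injective.
  have hcard : (((Finset.range D).filter fun j => c < s j).card : ℝ) ≤ d := by
    have : ((Finset.range D).filter fun j => c < s j).card ≤ (Finset.univ : Finset (Fin d')).card := by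
      refine Finset.card_le_card_of_forall_subsingleton
        (fun j i => ∃ i', i < i' ∧ (∃ k ∈ (a j).support, k ∈ E i) ∧ ∃ k ∈ (a j).support, k ∈ E i')
        (fun j hj => ?_) fun i _ => ?_
      · obtain ⟨i, i', h⟩ := htwo j (Finset.mem_filter.1 hj).2
        exact ⟨i, Finset.mem_univ i, i', h⟩
      · have hno : ∀ j j', (∃ i', i < i' ∧ (∃ k ∈ (a j).support, k ∈ E i) ∧
            ∃ k ∈ (a j).support, k ∈ E i') → (∃ k ∈ (a j').support, k ∈ E i) → ¬ j < j' := by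
          rintro j j' ⟨i', hii', -, k, hk, hkE⟩ ⟨k', hk', hkE'⟩ hjj'
          have h3 := hE _ _ hii' k' hkE' k hkE
          have h4 := ((ha j).2 k hk).2.trans (hK.monotone hjj')
          exact absurd (h3.trans_le h4) (not_lt.2 ((ha j').2 k' hk').1.le)
        rintro j ⟨-, hj⟩ j' ⟨-, hj'⟩
        exact le_antisymm (not_lt.1 (hno _ _ hj' hj.choose_spec.2.1))
          (not_lt.1 (hno _ _ hj hj'.choose_spec.2.1))
    rw [Finset.card_univ, Fintype.card_fin] at this
    exact_mod_cast this.trans hd'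
  refine (sum_tsirelsonNorm_coordProj_blockAverage_le h0 h1 a D E).trans ?_
  calc (D : ℝ)⁻¹ * ∑ j ∈ Finset.range D, s j ≤ (D : ℝ)⁻¹ * (D * c + d) :=
        mul_le_mul_of_nonneg_left ((sum_range_le_add_card hc hs1 D).trans (by linarith))
          (by positivity)
    _ = c + (D : ℝ)⁻¹ * d := by field_simp
    _ ≤ _ := by linarith

/-- Basis vectors start the induction with c = 1; one round multiplies c by 3/4 + 1/8 = 7/8. -/
theorem hasSpreadVectors_pow (h0 : 0 ≤ θ) (h2 : θ ≤ 1 / 2)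
    (hg : ∀ K : ℕ+, ∃ k, K < k ∧ δ ≤ g (Finsupp.single k 1)) (r : ℕ) :
    HasSpreadVectors θ g δ ((7 / 8) ^ r) := by
  have h1 : θ ≤ 1 := by linarith
  induction r with
  | zero =>
    intro K d
    obtain ⟨k, hk, hgk⟩ := hg K
    have hl1 : ∑ i ∈ (Finsupp.single k (1 : ℝ)).support, |Finsupp.single k (1 : ℝ) i| ≤ 1 := by
      rw [Finsupp.support_single (hb := one_ne_zero)]
      simp
    refine ⟨Finsupp.single k 1, fun i hi => ?_, hl1, hgk, fun d' _ E hE => ?_⟩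
    · rw [Finsupp.support_single (hb := one_ne_zero), Finset.mem_singleton] at hi
      rwa [hi]
    · rw [pow_zero]
      exact (sum_tsirelsonNorm_coordProj_le_sum h1 hE _).trans hl1
  | succ r ih =>
    have hpos : (0 : ℝ) < (7 / 8) ^ r := by positivity
    have := (ih.hasSmallVectors h0 h2 hpos).hasSpreadVectors h0 h1 (by positivity)
      (η := 1 / 8 * (7 / 8) ^ r) (by positivity)
    convert this using 1
    ring

/-- The unit vector basis is weakly null. -/
theorem exists_forall_map_single_lt (h0 : 0 ≤ θ) (h2 : θ ≤ 1 / 2)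
    (hg : ∀ x, g x ≤ tsirelsonNorm θ schreierFamily x) (hδ : 0 < δ) :
    ∃ K : ℕ+, ∀ k, K < k → g (Finsupp.single k 1) < δ := by
  by_contra hcon
  push Not at hcon
  obtain ⟨r, hr⟩ := exists_pow_lt_of_lt_one hδ (by norm_num : (7 / 8 : ℝ) < 1)
  obtain ⟨a, -, -, hga, ha⟩ :=
    (hasSpreadVectors_pow h0 h2 hcon r).hasSmallVectors h0 h2 (by positivity) 1
  have hpos : (0 : ℝ) < (7 / 8) ^ r := by positivity
  linarith [hg a]

end WeakNull

/-! ### The completion, its coordinates and its initial subspaces. -/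

section Space

open UniformSpace

variable {θ : Set.Ioo (0 : ℝ) 1} {F : Set (Finset ℕ+)}

/-- The inclusion of the finitely supported sequences into `T[θ, F]`. -/
noncomputable def toTsirelsonSpace (θ : Set.Ioo (0 : ℝ) 1) (F : Set (Finset ℕ+)) :
    (ℕ+ →₀ ℝ) →ₗ[ℝ] TsirelsonSpace θ F where
  toFun x := ((show TsirelsonC00 θ F from x : TsirelsonC00 θ F) : TsirelsonSpace θ F)
  map_add' x y := Completion.coe_add (α := TsirelsonC00 θ F) x y
  map_smul' c x := Completion.coe_smul (X := TsirelsonC00 θ F) c x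

theorem norm_toTsirelsonSpace (x : ℕ+ →₀ ℝ) :
    ‖toTsirelsonSpace θ F x‖ = tsirelsonNorm θ F x :=
  Completion.norm_coe (E := TsirelsonC00 θ F) x

theorem denseRange_toTsirelsonSpace : DenseRange (toTsirelsonSpace θ F) :=
  Completion.denseRange_coe (α := TsirelsonC00 θ F)

theorem exists_norm_sub_toTsirelsonSpace_lt (z : TsirelsonSpace θ F) {ε : ℝ} (hε : 0 < ε) :
    ∃ v, ‖z - toTsirelsonSpace θ F v‖ < ε := by
  obtain ⟨v, hv⟩ := (denseRange_toTsirelsonSpace (θ := θ) (F := F)).exists_dist_lt z hε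
  exact ⟨v, by rwa [← dist_eq_norm]⟩

/-- The coordinate functionals on `T[θ, F]`. -/
noncomputable def tsirelsonCoord (θ : Set.Ioo (0 : ℝ) 1) (F : Set (Finset ℕ+)) (p : ℕ+) :
    TsirelsonSpace θ F →L[ℝ] ℝ :=
  (Finsupp.lapply (R := ℝ) p : (ℕ+ →₀ ℝ) →ₗ[ℝ] ℝ).extendOfNorm (toTsirelsonSpace θ F)

theorem abs_apply_le_norm_toTsirelsonSpace (p : ℕ+) (x : ℕ+ →₀ ℝ) :
    ‖(Finsupp.lapply (R := ℝ) p : (ℕ+ →₀ ℝ) →ₗ[ℝ] ℝ) x‖ ≤ 1 * ‖toTsirelsonSpace θ F x‖ := by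
  rw [one_mul, norm_toTsirelsonSpace]
  exact abs_coord_le_tsirelsonNorm θ.2.2.le x p

theorem tsirelsonCoord_toTsirelsonSpace (p : ℕ+) (x : ℕ+ →₀ ℝ) :
    tsirelsonCoord θ F p (toTsirelsonSpace θ F x) = x p :=
  LinearMap.extendOfNorm_eq denseRange_toTsirelsonSpace
    ⟨1, abs_apply_le_norm_toTsirelsonSpace p⟩ x

theorem abs_tsirelsonCoord_le (p : ℕ+) (z : TsirelsonSpace θ F) :
    |tsirelsonCoord θ F p z| ≤ ‖z‖ := by
  have h := LinearMap.norm_extendOfNorm_apply_le denseRange_toTsirelsonSpace 1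
    (abs_apply_le_norm_toTsirelsonSpace (θ := θ) (F := F) p) z
  rwa [one_mul] at h

/-- The span of the first `m` basis vectors in `T[θ, F]`. -/
noncomputable def initialSubspace (θ : Set.Ioo (0 : ℝ) 1) (F : Set (Finset ℕ+)) (m : ℕ+) :
    Submodule ℝ (TsirelsonSpace θ F) :=
  (Finsupp.supported ℝ ℝ (Set.Iic m)).map (toTsirelsonSpace θ F)

instance (m : ℕ+) : FiniteDimensional ℝ (initialSubspace θ F m) := by
  have : Finite (Set.Iic m) := (Set.finite_Iic m).to_subtype
  have : FiniteDimensional ℝ (Finsupp.supported ℝ ℝ (Set.Iic m)) :=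
    Module.Finite.equiv (Finsupp.supportedEquivFinsupp (R := ℝ) (M := ℝ) (Set.Iic m)).symm
  unfold initialSubspace
  infer_instance

theorem toTsirelsonSpace_mem_initialSubspace {m : ℕ+} {x : ℕ+ →₀ ℝ}
    (hx : ∀ i ∈ x.support, i ≤ m) : toTsirelsonSpace θ F x ∈ initialSubspace θ F m :=
  Submodule.mem_map_of_mem fun i hi => hx i hi

/-! ### Isometries: late images, invariant subspaces, surjectivity. -/

variable (U : TsirelsonSpace θ schreierFamily →ₗᵢ[ℝ] TsirelsonSpace θ schreierFamily)

theorem eventually_abs_tsirelsonCoord_map_lt (h2 : (θ : ℝ) ≤ 1 / 2) (p : ℕ+) {ε : ℝ} (hε : 0 < ε) :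
    ∀ᶠ k in Filter.atTop, |tsirelsonCoord θ schreierFamily p
      (U (toTsirelsonSpace θ schreierFamily (Finsupp.single k 1)))| < ε := by
  let g : (ℕ+ →₀ ℝ) →ₗ[ℝ] ℝ := (tsirelsonCoord θ schreierFamily p).toLinearMap ∘ₗ
    U.toLinearMap ∘ₗ toTsirelsonSpace θ schreierFamily
  have hg : ∀ x, |g x| ≤ tsirelsonNorm θ schreierFamily x := fun x =>
    (abs_tsirelsonCoord_le p _).trans_eq ((U.norm_map _).trans (norm_toTsirelsonSpace x))
  obtain ⟨K, hK⟩ := exists_forall_map_single_lt (g := g) θ.2.1.le h2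
    (fun x => (le_abs_self _).trans (hg x)) hε
  obtain ⟨K', hK'⟩ := exists_forall_map_single_lt (g := -g) θ.2.1.le h2
    (fun x => (neg_le_abs _).trans (hg x)) hε
  filter_upwards [Filter.eventually_gt_atTop K, Filter.eventually_gt_atTop K'] with k hk hk'
  exact abs_lt.2 ⟨by have := hK' k hk'; rw [LinearMap.neg_apply] at this; exact neg_lt.1 this,
    hK k hk⟩

/-- The images of late basis vectors are almost supported far out. -/
theorem exists_norm_map_single_sub_lt (h2 : (θ : ℝ) ≤ 1 / 2) (K : ℕ+) {ε : ℝ} (hε : 0 < ε) :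
    ∃ k, K < k ∧ ∃ y : ℕ+ →₀ ℝ, (∀ i ∈ y.support, K < i) ∧
      ‖U (toTsirelsonSpace θ schreierFamily (Finsupp.single k 1)) -
        toTsirelsonSpace θ schreierFamily y‖ < ε := by
  set C : ℝ := (((Finset.Iic K).card : ℕ) : ℝ) with hC
  have hC0 : 0 ≤ C := Nat.cast_nonneg _
  -- Approximation costs η; deleting C coordinates of size at most 2η costs 2Cη.
  set η : ℝ := ε / (2 + 2 * C) with hη
  have hη0 : 0 < η := by positivity
  obtain ⟨k, hk, hkη⟩ := ((Filter.eventually_gt_atTop K).and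
    ((Filter.eventually_all_finset (Finset.Iic K)).2 fun p _ =>
      eventually_abs_tsirelsonCoord_map_lt U h2 p hη0)).exists
  set z := U (toTsirelsonSpace θ schreierFamily (Finsupp.single k 1)) with hz
  obtain ⟨v, hv⟩ := exists_norm_sub_toTsirelsonSpace_lt z hη0
  have hvp : ∀ p ∈ Finset.Iic K, |v p| ≤ 2 * η := fun p hp => by
    have h3 := (abs_tsirelsonCoord_le p (z - toTsirelsonSpace θ schreierFamily v)).trans hv.le
    rw [map_sub, tsirelsonCoord_toTsirelsonSpace] at h3
    have h4 := abs_le.1 h3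
    have h5 := abs_lt.1 (hkη p hp)
    exact abs_le.2 ⟨by linarith, by linarith⟩
  have hproj : tsirelsonNorm θ schreierFamily (coordProj (Finset.Iic K) v) ≤ C * (2 * η) := by
    refine (tsirelsonNorm_le_sum θ.2.2.le _).trans ?_
    rw [sum_abs_support_eq (s := Finset.Iic K)]
    · refine (Finset.sum_le_sum fun p hp => (abs_coordProj_le _ v p).trans (hvp p hp)).trans_eq ?_
      simp [hC]
    · intro p hp
      by_contra hpK
      rw [Finsupp.mem_support_iff, coordProj_apply, if_neg hpK] at hp
      exact hp rfl
  refine ⟨k, hk, v - coordProj (Finset.Iic K) v, fun i hi => ?_, ?_⟩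
  · by_contra hiK
    rw [Finsupp.mem_support_iff, Finsupp.sub_apply, coordProj_apply,
      if_pos (Finset.mem_Iic.2 (not_lt.1 hiK)), sub_self] at hi
    exact hi rfl
  · rw [map_sub, sub_sub_eq_add_sub, add_sub_right_comm]
    refine (norm_add_le _ _).trans_lt ?_
    rw [norm_toTsirelsonSpace]
    have h6 : (2 + 2 * C) * η = ε := by rw [hη]; field_simp
    nlinarith

/-- A vector with a nonzero part beyond `m`, followed by `m` blocks, has the `m + 1` pieces beyond
`m` admissible. -/
theorem mul_add_sum_le_tsirelsonNorm {m : ℕ+} {K : ℕ → ℕ+} (hm : m < K 0) (hK : StrictMono K)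
    {v : ℕ+ →₀ ℝ} (hv : ∀ i ∈ v.support, i ≤ K 0) {y : ℕ → ℕ+ →₀ ℝ}
    (hy : ∀ j, ∀ i ∈ (y j).support, K j < i ∧ i ≤ K (j + 1)) :
    (θ : ℝ) * (tsirelsonNorm θ schreierFamily (v - coordProj (Finset.Iic m) v) +
      ∑ j ∈ Finset.range m, tsirelsonNorm θ schreierFamily (y j)) ≤
      tsirelsonNorm θ schreierFamily (v + ∑ j ∈ Finset.range m, y j) := by
  -- Prepending m to the cut points makes (m, K 0] the first of m + 1 intervals; all their elements
  -- are at least m + 1, exactly as admissibility requires.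
  let L : ℕ → ℕ+ := fun j => Nat.casesOn j m K
  have hL : StrictMono L := strictMono_nat_of_lt_succ fun j => by
    cases j with
    | zero => exact hm
    | succ j => exact hK (Nat.lt_succ_self j)
  let E : Fin ((m : ℕ) + 1) → Finset ℕ+ := fun i => Finset.Ioc (L i) (L (i + 1))
  have hE : IsAdmissible schreierFamily E := by
    rw [isAdmissible_schreierFamily_iff]
    refine ⟨fun i j hij a ha b hb => ?_, fun i => ?_, fun i a ha => ?_⟩
    · have h3 : L (i + 1) ≤ L j := hL.monotone hij
      exact ((Finset.mem_Ioc.1 ha).2.trans h3).trans_lt (Finset.mem_Ioc.1 hb).1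
    · exact Finset.nonempty_Ioc.2 (hL (Nat.lt_succ_self i))
    · have h3 : m < a := (hL.monotone (Nat.zero_le (i : ℕ))).trans_lt (Finset.mem_Ioc.1 ha).1
      exact_mod_cast h3
  refine le_trans (le_of_eq ?_) (mul_sum_tsirelsonNorm_coordProj_le θ.2.2.le hE _)
  have hhead : coordProj (E 0) (v + ∑ j ∈ Finset.range m, y j) =
      v - coordProj (Finset.Iic m) v := by
    rw [coordProj_add, coordProj_sum, Finset.sum_eq_zero fun j _ => ?_, add_zero]
    · ext i
      rw [Finsupp.sub_apply, coordProj_apply, coordProj_apply]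
      have hE0 : E 0 = Finset.Ioc m (K 0) := rfl
      simp only [hE0, Finset.mem_Ioc, Finset.mem_Iic]
      by_cases him : i ≤ m
      · rw [if_pos him, if_neg fun h => absurd h.1 (not_lt.2 him), sub_self]
      · rw [if_neg him, sub_zero]
        split_ifs with h
        · rfl
        · by_contra h'
          exact h ⟨not_le.1 him, hv i (Finsupp.mem_support_iff.2 (Ne.symm h'))⟩
    · refine coordProj_eq_zero fun i hi hiE => ?_
      have h3 : i ≤ K 0 := (Finset.mem_Ioc.1 hiE).2
      exact absurd ((hK.monotone (Nat.zero_le j)).trans_lt (hy j i hi).1) (not_lt.2 h3)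
  have htail : ∀ j : Fin m, coordProj (E j.succ) (v + ∑ j ∈ Finset.range m, y j) = y j := by
    intro j
    have hEj : E j.succ = Finset.Ioc (K j) (K (j + 1)) := rfl
    rw [hEj, coordProj_add, coordProj_sum, Finset.sum_eq_single (j : ℕ), coordProj_eq_zero,
      zero_add, coordProj_eq_self]
    · exact fun i hi => Finset.mem_Ioc.2 (hy j i hi)
    · intro i hi hiE
      exact absurd ((hv i hi).trans (hK.monotone (Nat.zero_le j)))
        (not_le.2 (Finset.mem_Ioc.1 hiE).1)
    · intro j' _ hj'
      refine coordProj_eq_zero fun i hi hiE => ?_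
      have h3 := Finset.mem_Ioc.1 hiE
      have h4 := hy j' i hi
      rcases lt_or_gt_of_ne hj' with h | h
      · exact absurd (h4.2.trans (hK.monotone h)) (not_le.2 h3.1)
      · exact absurd (h3.2.trans (hK.monotone h)) (not_le.2 h4.1)
    · exact fun h => absurd (Finset.mem_range.2 j.2) h
  rw [Fin.sum_univ_succ, hhead]
  simp only [htail]
  rw [Fin.sum_univ_eq_sum_range (fun j => tsirelsonNorm θ schreierFamily (y j))]

/-- If `U z` were at distance ρ > 0 from the subspace, its part beyond m would be an extra
admissible piece, adding about θρ to the norm θmt allowed by the upper estimate. -/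
theorem map_mem_initialSubspace (h2 : (θ : ℝ) ≤ 1 / 2) {m : ℕ+} (hm : 1 ≤ (θ : ℝ) * (m : ℕ))
    {z : TsirelsonSpace θ schreierFamily} (hz : z ∈ initialSubspace θ schreierFamily m) :
    U z ∈ initialSubspace θ schreierFamily m := by
  obtain ⟨x, hx, rfl⟩ := hz
  have hx' : ∀ i ∈ x.support, i ≤ m := fun i hi => hx hi
  have h0 : 0 < (θ : ℝ) := θ.2.1
  have h1 : (θ : ℝ) ≤ 1 := θ.2.2.le
  by_contra hcon
  obtain ⟨ρ, hρ, hball⟩ := Metric.isOpen_iff.1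
    (initialSubspace θ schreierFamily m).closed_of_finiteDimensional.isOpen_compl _ hcon
  have hdist : ∀ w ∈ initialSubspace θ schreierFamily m,
      ρ ≤ ‖U (toTsirelsonSpace θ schreierFamily x) - w‖ := fun w hw => by
    by_contra hlt
    refine hball (a := w) ?_ hw
    rw [Metric.mem_ball, dist_eq_norm, norm_sub_rev]
    exact not_le.1 hlt
  set t : ℝ := (m : ℕ) * ∑ k ∈ x.support, |x k| with ht
  have ht0 : 0 ≤ t := mul_nonneg (Nat.cast_nonneg _) (Finset.sum_nonneg fun _ _ => abs_nonneg _)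
  -- R weights the approximation errors: one for `v`, and t for each of the m blocks.
  set R : ℝ := 1 + t * (m : ℕ) with hR
  have hR0 : 0 < R := by positivity
  set ε : ℝ := θ * ρ / (4 * R) with hε
  have hε0 : 0 < ε := by positivity
  obtain ⟨v, hv⟩ := exists_norm_sub_toTsirelsonSpace_lt
    (U (toTsirelsonSpace θ schreierFamily x)) hε0
  obtain ⟨K₀, hmK₀, hvK₀⟩ : ∃ K₀, m < K₀ ∧ ∀ i ∈ v.support, i ≤ K₀ :=
    ⟨(insert (m + 1) v.support).max' (Finset.insert_nonempty _ _),
      (PNat.lt_add_right m 1).trans_le (Finset.le_max' _ _ (Finset.mem_insert_self _ _)),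
      fun i hi => Finset.le_max' _ _ (Finset.mem_insert_of_mem hi)⟩
  obtain ⟨K, a, hK0, hK, ha⟩ := exists_block_sequence
    (fun _ (a : ℕ+ × (ℕ+ →₀ ℝ)) =>
      ‖U (toTsirelsonSpace θ schreierFamily (Finsupp.single a.1 1)) -
        toTsirelsonSpace θ schreierFamily a.2‖ < ε)
    (fun a => insert a.1 a.2.support)
    (fun K => by
      obtain ⟨k, hk, y, hy, hky⟩ := exists_norm_map_single_sub_lt U h2 K hε0
      refine ⟨(k, y), hky, fun i hi => ?_⟩
      rcases Finset.mem_insert.1 hi with rfl | hi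
      · exact hk
      · exact hy i hi) K₀
  subst hK0
  have hk : ∀ j, K j < (a j).1 ∧ (a j).1 ≤ K (j + 1) := fun j =>
    (ha j).2 _ (Finset.mem_insert_self _ _)
  have hy : ∀ j, ∀ i ∈ (a j).2.support, K j < i ∧ i ≤ K (j + 1) := fun j i hi =>
    (ha j).2 _ (Finset.mem_insert_of_mem hi)
  have hkmono : StrictMono fun j => (a j).1 := strictMono_nat_of_lt_succ fun j =>
    (hk j).2.trans_lt (hk (j + 1)).1
  set S : Finset ℕ+ := (Finset.range m).image fun j => (a j).1 with hS
  have hSsum : basisSum S = ∑ j ∈ Finset.range m, Finsupp.single (a j).1 1 :=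
    Finset.sum_image fun i _ j _ hij => hkmono.injective hij
  have hupper : ‖toTsirelsonSpace θ schreierFamily (x + t • basisSum S)‖ ≤ θ * ((m : ℕ) * t) := by
    rw [norm_toTsirelsonSpace]
    refine tsirelsonNorm_add_smul_basisSum_le h0.le h2 hm hx' (fun k hk' => ?_) ?_ le_rfl
    · obtain ⟨j, -, rfl⟩ := Finset.mem_image.1 hk'
      exact (hmK₀.trans_le (hK.monotone (Nat.zero_le j))).trans (hk j).1
    · rw [hS, Finset.card_image_of_injective _ hkmono.injective, Finset.card_range]
  rw [← U.norm_map, map_add, map_add, map_smul, map_smul, hSsum, map_sum, map_sum] at hupper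
  have hlower := mul_add_sum_le_tsirelsonNorm (θ := θ) hmK₀ hK hvK₀ (y := fun j => t • (a j).2)
    fun j i hi => hy j i (Finsupp.support_smul hi)
  have hdiff : ‖toTsirelsonSpace θ schreierFamily (v + ∑ j ∈ Finset.range m, t • (a j).2) -
      (U (toTsirelsonSpace θ schreierFamily x) + t • ∑ j ∈ Finset.range m,
        U (toTsirelsonSpace θ schreierFamily (Finsupp.single (a j).1 1)))‖ ≤ ε * R := by
    rw [map_add, map_sum, Finset.smul_sum, add_sub_add_comm, ← Finset.sum_sub_distrib]
    refine (norm_add_le _ _).trans ?_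
    rw [norm_sub_rev]
    refine (add_le_add hv.le ((norm_sum_le _ _).trans
      (Finset.sum_le_sum (g := fun _ => t * ε) fun j _ => ?_))).trans_eq ?_
    · rw [map_smul, ← smul_sub, norm_smul, Real.norm_of_nonneg ht0, norm_sub_rev]
      exact mul_le_mul_of_nonneg_left (ha j).1.le ht0
    · rw [Finset.sum_const, Finset.card_range, nsmul_eq_mul, hR]
      ring
  have hhead : ρ - ε ≤ tsirelsonNorm θ schreierFamily (v - coordProj (Finset.Iic m) v) := by
    have h3 := hdist (toTsirelsonSpace θ schreierFamily (coordProj (Finset.Iic m) v))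
      (toTsirelsonSpace_mem_initialSubspace fun i hi => by
        by_contra him
        rw [Finsupp.mem_support_iff, coordProj_apply,
          if_neg fun h => him (Finset.mem_Iic.1 h)] at hi
        exact hi rfl)
    have h4 := norm_sub_le_norm_sub_add_norm_sub (U (toTsirelsonSpace θ schreierFamily x))
      (toTsirelsonSpace θ schreierFamily v)
      (toTsirelsonSpace θ schreierFamily (coordProj (Finset.Iic m) v))
    rw [← map_sub, norm_toTsirelsonSpace] at h4
    linarith
  have htail : t * (m : ℕ) * (1 - ε) ≤
      ∑ j ∈ Finset.range m, tsirelsonNorm θ schreierFamily (t • (a j).2) := by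
    have hterm : ∀ j ∈ Finset.range (m : ℕ),
        t * (1 - ε) ≤ tsirelsonNorm θ schreierFamily (t • (a j).2) := fun j _ => by
      rw [tsirelsonNorm_smul h0.le h1, abs_of_nonneg ht0]
      refine mul_le_mul_of_nonneg_left ?_ ht0
      have h3 := norm_sub_norm_le (U (toTsirelsonSpace θ schreierFamily (Finsupp.single (a j).1 1)))
        (toTsirelsonSpace θ schreierFamily (a j).2)
      rw [U.norm_map, norm_toTsirelsonSpace, norm_toTsirelsonSpace, tsirelsonNorm_single h1] at h3
      linarith [(ha j).1]
    refine le_trans (le_of_eq ?_) (Finset.sum_le_sum hterm)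
    rw [Finset.sum_const, Finset.card_range, nsmul_eq_mul]
    ring
  have hw : tsirelsonNorm θ schreierFamily (v + ∑ j ∈ Finset.range m, t • (a j).2) ≤
      θ * ((m : ℕ) * t) + ε * R := by
    rw [← norm_toTsirelsonSpace]
    exact (norm_le_norm_add_norm_sub' _ _).trans (add_le_add hupper hdiff)
  have hεR : 4 * (ε * R) = θ * ρ := by
    rw [hε]
    field_simp
  -- After cancelling θmt this reads θρ ≤ (1 + θ)εR ≤ 2εR = θρ/2, which is absurd.
  have hkey : θ * ((ρ - ε) + t * (m : ℕ) * (1 - ε)) ≤ θ * ((m : ℕ) * t) + ε * R :=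
    (mul_le_mul_of_nonneg_left (add_le_add hhead htail) h0.le).trans (hlower.trans hw)
  have hid : θ * ((ρ - ε) + t * (m : ℕ) * (1 - ε)) = θ * ρ + θ * ((m : ℕ) * t) - θ * (ε * R) := by
    rw [hR]
    ring
  have hpos : 0 < ε * R := by positivity
  nlinarith

theorem initialSubspace_le_range (h2 : (θ : ℝ) ≤ 1 / 2) {m : ℕ+} (hm : 1 ≤ (θ : ℝ) * (m : ℕ))
    {z : TsirelsonSpace θ schreierFamily} (hz : z ∈ initialSubspace θ schreierFamily m) :
    z ∈ Set.range U := by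
  have hinj : Function.Injective (U.toLinearMap.restrict (p := initialSubspace θ schreierFamily m)
      (q := initialSubspace θ schreierFamily m) fun w hw => map_mem_initialSubspace U h2 hm hw) :=
    fun w w' h => Subtype.ext (U.injective (congrArg Subtype.val h))
  obtain ⟨w, hw⟩ := LinearMap.injective_iff_surjective.1 hinj ⟨z, hz⟩
  exact ⟨w, congrArg Subtype.val hw⟩

theorem surjective_of_le_half (h2 : (θ : ℝ) ≤ 1 / 2) : Function.Surjective U := by
  have hclosed : IsClosed (Set.range U) := U.isometry.isClosedEmbedding.isClosed_range
  obtain ⟨N, hN⟩ := exists_nat_gt ((θ : ℝ)⁻¹)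
  have hθ : 0 < (θ : ℝ) := θ.2.1
  have hsub : Set.range (toTsirelsonSpace θ schreierFamily) ⊆ Set.range U := by
    rintro _ ⟨x, rfl⟩
    -- Inserting N + 1 ensures θm ≥ 1 however short the support of `x` is.
    set m : ℕ+ := (insert (N.succPNat) x.support).max' (Finset.insert_nonempty _ _) with hm
    have hNm : N.succPNat ≤ m := Finset.le_max' _ _ (Finset.mem_insert_self _ _)
    have hNm' : N ≤ (m : ℕ) := (Nat.le_succ N).trans (by exact_mod_cast hNm)
    refine initialSubspace_le_range U h2 (m := m) ?_ (toTsirelsonSpace_mem_initialSubspace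
      fun i hi => Finset.le_max' _ _ (Finset.mem_insert_of_mem hi))
    have h3 : (θ : ℝ)⁻¹ ≤ (m : ℕ) := hN.le.trans (by exact_mod_cast hNm')
    rwa [inv_le_iff_one_le_mul₀' hθ] at h3
  have hdense : Dense (Set.range U) := denseRange_toTsirelsonSpace.mono hsub
  exact Set.range_eq_univ.1 (hclosed.closure_eq ▸ hdense.closure_eq)

end Space

theorem mainTheorem8 (n : ℕ) (hn : 2 ≤ n)
    (U : TsirelsonSpace ⟨1 / n, one_div_mem_Ioo hn⟩ schreierFamily →ₗᵢ[ℝ]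
      TsirelsonSpace ⟨1 / n, one_div_mem_Ioo hn⟩ schreierFamily) :
    Function.Surjective U := by
  refine surjective_of_le_half U ?_
  have hn' : (2 : ℝ) ≤ n := by exact_mod_cast hn
  exact one_div_le_one_div_of_le two_pos hn'
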